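/- **Model.** Fix a horizon $T\in\mathbb N$. In each slot $t=1,\dots,T$ a triple $(v_t,x_t,q_t)$ is drawn i.i.d. from an unknown distribution $\mathcal D$, where $v_t\in[0,1]$ is a value, $x_t:[0,\infty)\to[0,1]$ is a non-decreasing allocation function with $x_t(0)=0$, and $q_t:[0,\infty)\to[0,1]$ is a non-decreasing payment function with $q_t(b)\le b$ and $q_t(b)=0$ whenever $x_t(b)=0$. Put $p_t(b)=q_t(b)\,x_t(b)$. An online algorithm $\mathcal A$ (possibly randomized, possibly depending on $T$, but not knowing $\mathcal D$) chooses a bid $b_t\ge 0$ as a function of its internal randomness, the past observations $(v_\tau,x_\tau(b_\tau),p_\tau(b_\tau))_{\tau<t}$ and $v_t$. Let $V_{\mathcal A}(T)=\mathbb E\big[\sum_{t=1}^T v_t x_t(b_t)\big]$. The algorithm satisfies the return-on-spend constraint (ROSC) under $\mathcal D$ if $$\mathbb E\Big[\sum_{t=1}^T p_t(b_t)\Big]\le \mathbb E\Big[\sum_{t=1}^T v_t x_t(b_t)\Big],$$ and it respects the ROSC if this holds under every $\mathcal D$. Let $V_{\mathsf{OPT}}(T)$ be the supremum of $V_{\mathcal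 B}(T)$ over all online algorithms $\mathcal B$, allowed to depend on $\mathcal D$, that satisfy the ROSC under $\mathcal D$, and let $\mathcal R_{\mathcal A}(T)=\sup_{\mathcal D}\big(V_{\mathsf{OPT}}(T)-V_{\mathcal A}(T)\big)$ be the regret of $\mathcal A$. **Corollary.** Let $\mathcal A_s$ be the algorithm that always bids $b_t=v_t$. Then $\mathcal A_s$ respects the ROSC for every $T$, and it is order-wise optimal among the algorithms that respect the ROSC. Precisely, there are universal constants $C,c,K>0$ such that for every $T$: $\mathcal R_{\mathcal A_s}(T)\le C\,T$; and every online algorithm $\mathcal A$ that respects the ROSC at horizon $T$ has $\mathcal R_{\mathcal A}(T)\ge c\,T$ and $\mathcal R_{\mathcal A_s}(T)\le K\,\mathcal R_{\mathcal A}(T)$. -/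

import Mathlib

open MeasureTheory
open scoped NNReal

noncomputable section

namespace AutoBidding

/-- The distribution of one ad query `(v, x, q)`: a probability space `Slot` together with a random
value `v`, a random allocation function `x` and a random payment function `q`, the two random
functions being jointly measurable in the outcome and the bid. -/
structure InputLaw where
  Slot : Type
  [measurableSlot : MeasurableSpace Slot]
  law : Measure Slot
  [isProb : IsProbabilityMeasure law]
  v : Slot → ℝ≥0
  x : Slot → ℝ≥0 → ℝ
  q : Slot → ℝ≥0 → ℝ
  measurable_v : Measurable v
  measurable_x : Measurable (Function.uncurry x)
  measurable_q : Measurable (Function.uncurry q)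
  v_le_one : ∀ z, v z ≤ 1
  x_mem : ∀ z b, x z b ∈ Set.Icc (0 : ℝ) 1
  x_mono : ∀ z, Monotone (x z)
  x_zero : ∀ z, x z 0 = 0
  q_mem : ∀ z b, q z b ∈ Set.Icc (0 : ℝ) 1
  q_mono : ∀ z, Monotone (q z)
  q_eq_zero : ∀ z b, x z b = 0 → q z b = 0
  q_le_bid : ∀ z b, q z b ≤ (b : ℝ)

attribute [instance] InputLaw.measurableSlot InputLaw.isProb

/-- The expected payment function `p(b) = q(b) x(b)`. -/
def InputLaw.p (D : InputLaw) (z : D.Slot) (b : ℝ≥0) : ℝ := D.q z b * D.x z b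

/-- What is known about a past slot: `(v_τ, x_τ(b_τ), p_τ(b_τ))`. -/
abbrev Obs : Type := ℝ≥0 × ℝ × ℝ

/-- A (possibly randomized) online algorithm: a random seed, drawn once and independently of the
input, and for every slot a bid that is a measurable function of the seed, of the observations
from the earlier slots and of the present value. Slots are numbered from `0`. -/
structure Algorithm where
  Seed : Type
  [measurableSeed : MeasurableSpace Seed]
  seedLaw : Measure Seed
  [isProb : IsProbabilityMeasure seedLaw]
  bid : (t : ℕ) → Seed → (Fin t → Obs) → ℝ≥0 → ℝ≥0
  measurable_bid : ∀ t : ℕ,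
    Measurable (fun a : Seed × (Fin t → Obs) × ℝ≥0 => bid t a.1 a.2.1 a.2.2)

attribute [instance] Algorithm.measurableSeed Algorithm.isProb

/-- The observations made before slot `t` when `A` is run with seed `s` on the queries `z`. -/
def history (A : Algorithm) (D : InputLaw) (s : A.Seed) (z : ℕ → D.Slot) :
    (t : ℕ) → Fin t → Obs
  | 0 => Fin.elim0
  | t + 1 =>
    let b := A.bid t s (history A D s z t) (D.v (z t))
    Fin.snoc (α := fun _ => Obs) (history A D s z t) (D.v (z t), D.x (z t) b, D.p (z t) b)

/-- The bid `b_t` of `A` in slot `t`. -/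
def bidAt (A : Algorithm) (D : InputLaw) (s : A.Seed) (z : ℕ → D.Slot) (t : ℕ) : ℝ≥0 :=
  A.bid t s (history A D s z t) (D.v (z t))

/-- The joint law of the seed and of the i.i.d. sequence of queries. -/
def runLaw (A : Algorithm) (D : InputLaw) : Measure (A.Seed × (ℕ → D.Slot)) :=
  A.seedLaw.prod (Measure.infinitePi fun _ : ℕ => D.law)

/-- Total expected accrued valuation `V_A(T) = E ∑_t v_t x_t(b_t)` over the first `T` slots. -/
def value (A : Algorithm) (D : InputLaw) (T : ℕ) : ℝ :=
  ∫ w, ∑ t ∈ Finset.range T, (D.v (w.2 t) : ℝ) * D.x (w.2 t) (bidAt A D w.1 w.2 t) ∂runLaw A D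

/-- Total expected payment `E ∑_t p_t(b_t)` over the first `T` slots. -/
def payment (A : Algorithm) (D : InputLaw) (T : ℕ) : ℝ :=
  ∫ w, ∑ t ∈ Finset.range T, D.p (w.2 t) (bidAt A D w.1 w.2 t) ∂runLaw A D

/-- The return-on-spend constraint for `A` under `D` with horizon `T`. -/
def ROSC (A : Algorithm) (D : InputLaw) (T : ℕ) : Prop := payment A D T ≤ value A D T

/-- `A` strictly satisfies the ROSC at horizon `T`: whatever the unknown distribution is. -/
def RespectsROSC (A : Algorithm) (T : ℕ) : Prop := ∀ D : InputLaw, ROSC A D T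

/-- The benchmark `V_OPT(T)`: the best value of an online algorithm that may be tailored to `D` and
satisfies the ROSC under `D`. The supremum is over a set of numbers in `[0, T]`. -/
def optValue (D : InputLaw) (T : ℕ) : ℝ :=
  sSup {r : ℝ | ∃ B : Algorithm, ROSC B D T ∧ value B D T = r}

/-- The worst-case regret. The supremum is over a set of numbers in `[-T, T]`. -/
def regret (A : Algorithm) (T : ℕ) : ℝ :=
  sSup {r : ℝ | ∃ D : InputLaw, optValue D T - value A D T = r}

/-- The algorithm that always bids `b_t = v_t`. -/
def truthful : Algorithm where
  Seed := Unit
  seedLaw := Measure.dirac ()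
  bid := fun _ _ _ v => v
  measurable_bid := fun _ => measurable_snd.comp measurable_snd

end AutoBidding

end

/-!
An algorithm that respects the constraint must be prepared for a query of value `v < 1` which only
bids of at least `1` win, at a charge of `1`. Every win violates the constraint there, so almost
surely all its bids stay below `1`. If the same query is instead sold at charge `0`, nothing tells
the two cases apart before the first win, so the algorithm still loses every slot, while always
bidding `1` is feasible and collects `v` per slot. As `v → 1` the regret reaches the trivial upper
bound `T`, whichever algorithm was chosen.
-/

noncomputable section

namespace AutoBidding

namespace InputLaw

variable (D : InputLaw)

theorem p_mem (z : D.Slot) (b : ℝ≥0) : D.p z b ∈ Set.Icc (0 : ℝ) 1 :=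
  unitInterval.mul_mem (D.q_mem z b) (D.x_mem z b)

theorem v_mul_x_mem (z : D.Slot) (b : ℝ≥0) : (D.v z : ℝ) * D.x z b ∈ Set.Icc (0 : ℝ) 1 :=
  unitInterval.mul_mem ⟨(D.v z).coe_nonneg, by exact_mod_cast D.v_le_one z⟩ (D.x_mem z b)

theorem measurable_p : Measurable (Function.uncurry D.p) :=
  D.measurable_q.mul D.measurable_x

theorem measurable_v_mul_x : Measurable (Function.uncurry fun z b => (D.v z : ℝ) * D.x z b) :=
  (D.measurable_v.comp measurable_fst).coe_nnreal_real.mul D.measurable_x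

end InputLaw

section Integrability

variable (A : Algorithm) (D : InputLaw)

instance isProbabilityMeasure_runLaw : IsProbabilityMeasure (runLaw A D) :=
  inferInstanceAs (IsProbabilityMeasure (A.seedLaw.prod _))

theorem measurable_bidAt_of_measurable_history {t : ℕ}
    (h : Measurable fun w : A.Seed × (ℕ → D.Slot) => history A D w.1 w.2 t) :
    Measurable fun w : A.Seed × (ℕ → D.Slot) => bidAt A D w.1 w.2 t :=
  (A.measurable_bid t).comp (measurable_fst.prodMk (h.prodMk
    (D.measurable_v.comp ((measurable_pi_apply t).comp measurable_snd))))

theorem measurable_history (t : ℕ) :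
    Measurable fun w : A.Seed × (ℕ → D.Slot) => history A D w.1 w.2 t := by
  induction t with
  | zero => exact measurable_pi_iff.2 fun i => i.elim0
  | succ t ih =>
    have hquery : Measurable fun w : A.Seed × (ℕ → D.Slot) => w.2 t :=
      (measurable_pi_apply t).comp measurable_snd
    have hquery_bid := hquery.prodMk (measurable_bidAt_of_measurable_history A D ih)
    refine measurable_pi_iff.2 (Fin.lastCases ?_ fun i => ?_)
    · simp only [history, Fin.snoc_last]
      exact (D.measurable_v.comp hquery).prodMk
        ((D.measurable_x.comp hquery_bid).prodMk (D.measurable_p.comp hquery_bid))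
    · simp only [history, Fin.snoc_castSucc]
      exact (measurable_pi_apply i).comp ih

theorem measurable_bidAt (t : ℕ) :
    Measurable fun w : A.Seed × (ℕ → D.Slot) => bidAt A D w.1 w.2 t :=
  measurable_bidAt_of_measurable_history A D (measurable_history A D t)

theorem integrable_sum_bidAt {f : D.Slot → ℝ≥0 → ℝ} (hf : Measurable (Function.uncurry f)) {C : ℝ}
    (hC : ∀ z b, ‖f z b‖ ≤ C) (T : ℕ) :
    Integrable (fun w => ∑ t ∈ Finset.range T, f (w.2 t) (bidAt A D w.1 w.2 t)) (runLaw A D) := by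
  refine integrable_finsetSum _ fun t _ => .of_bound ?_ C (ae_of_all _ fun w => hC _ _)
  exact (hf.comp (((measurable_pi_apply t).comp measurable_snd).prodMk
    (measurable_bidAt A D t))).aestronglyMeasurable

theorem integrable_sum_value (T : ℕ) :
    Integrable (fun w => ∑ t ∈ Finset.range T,
      (D.v (w.2 t) : ℝ) * D.x (w.2 t) (bidAt A D w.1 w.2 t)) (runLaw A D) :=
  integrable_sum_bidAt A D D.measurable_v_mul_x
    (fun z b => (Real.norm_of_nonneg (D.v_mul_x_mem z b).1).trans_le (D.v_mul_x_mem z b).2) T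

theorem integrable_sum_payment (T : ℕ) :
    Integrable (fun w => ∑ t ∈ Finset.range T, D.p (w.2 t) (bidAt A D w.1 w.2 t))
      (runLaw A D) :=
  integrable_sum_bidAt A D D.measurable_p
    (fun z b => (Real.norm_of_nonneg (D.p_mem z b).1).trans_le (D.p_mem z b).2) T

end Integrability

section Regret

theorem value_nonneg (A : Algorithm) (D : InputLaw) (T : ℕ) : 0 ≤ value A D T :=
  integral_nonneg fun _ => Finset.sum_nonneg fun _ _ => (D.v_mul_x_mem _ _).1

theorem value_le (A : Algorithm) (D : InputLaw) (T : ℕ) : value A D T ≤ T := by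
  have hsum (w : A.Seed × (ℕ → D.Slot)) :
      ∑ t ∈ Finset.range T, (D.v (w.2 t) : ℝ) * D.x (w.2 t) (bidAt A D w.1 w.2 t) ≤ T := by
    simpa using Finset.sum_le_card_nsmul (Finset.range T) _ 1 fun t _ => (D.v_mul_x_mem _ _).2
  simpa only [value, integral_const, probReal_univ, one_smul] using
    integral_mono (integrable_sum_value A D T) (integrable_const (T : ℝ)) hsum

theorem respectsROSC_truthful (T : ℕ) : RespectsROSC truthful T := fun D =>
  integral_mono (integrable_sum_payment truthful D T) (integrable_sum_value truthful D T)
    fun w => Finset.sum_le_sum fun t _ =>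
      mul_le_mul_of_nonneg_right (D.q_le_bid (w.2 t) (D.v (w.2 t))) (D.x_mem _ _).1

theorem value_le_optValue {B : Algorithm} {D : InputLaw} {T : ℕ} (h : ROSC B D T) :
    value B D T ≤ optValue D T :=
  le_csSup ⟨T, by rintro _ ⟨B, -, rfl⟩; exact value_le B D T⟩ ⟨B, h, rfl⟩

theorem optValue_le (D : InputLaw) (T : ℕ) : optValue D T ≤ T :=
  Real.sSup_le (by rintro _ ⟨B, -, rfl⟩; exact value_le B D T) T.cast_nonneg

theorem optValue_sub_value_le (A : Algorithm) (D : InputLaw) (T : ℕ) :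
    optValue D T - value A D T ≤ T :=
  (sub_le_self _ (value_nonneg A D T)).trans (optValue_le D T)

theorem regret_le (A : Algorithm) (T : ℕ) : regret A T ≤ T :=
  Real.sSup_le (by rintro _ ⟨D, rfl⟩; exact optValue_sub_value_le A D T) T.cast_nonneg

theorem optValue_sub_value_le_regret (A : Algorithm) (D : InputLaw) (T : ℕ) :
    optValue D T - value A D T ≤ regret A T :=
  le_csSup ⟨T, by rintro _ ⟨D, rfl⟩; exact optValue_sub_value_le A D T⟩ ⟨D, rfl⟩

end Regret

section Indistinguishability

variable (A : Algorithm) {D D' : InputLaw} (s : A.Seed) {z : ℕ → D.Slot} {z' : ℕ → D'.Slot} {t : ℕ}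

theorem history_congr (hv : ∀ i < t, D'.v (z' i) = D.v (z i))
    (hx : ∀ i < t, D'.x (z' i) (bidAt A D s z i) = D.x (z i) (bidAt A D s z i))
    (hp : ∀ i < t, D'.p (z' i) (bidAt A D s z i) = D.p (z i) (bidAt A D s z i)) :
    history A D' s z' t = history A D s z t := by
  induction t with
  | zero => rfl
  | succ t ih =>
    have hpast := ih (fun i hi => hv i (hi.trans t.lt_succ_self))
      (fun i hi => hx i (hi.trans t.lt_succ_self)) (fun i hi => hp i (hi.trans t.lt_succ_self))
    have hxt := hx t t.lt_succ_self
    have hpt := hp t t.lt_succ_self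
    rw [bidAt] at hxt hpt
    simp only [history, hpast, hv t t.lt_succ_self, hxt, hpt]

theorem bidAt_congr (hv : ∀ i ≤ t, D'.v (z' i) = D.v (z i))
    (hx : ∀ i < t, D'.x (z' i) (bidAt A D s z i) = D.x (z i) (bidAt A D s z i))
    (hp : ∀ i < t, D'.p (z' i) (bidAt A D s z i) = D.p (z i) (bidAt A D s z i)) :
    bidAt A D' s z' t = bidAt A D s z t := by
  rw [bidAt, bidAt, history_congr A s (fun i hi => hv i hi.le) hx hp, hv t le_rfl]

end Indistinguishability

theorem ae_value_eq_payment_of_ROSC {A : Algorithm} {D : InputLaw} {T : ℕ}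
    (hD : ∀ z b, (D.v z : ℝ) * D.x z b ≤ D.p z b) (h : ROSC A D T) :
    ∀ᵐ w ∂runLaw A D, ∀ t < T, (D.v (w.2 t) : ℝ) * D.x (w.2 t) (bidAt A D w.1 w.2 t) =
      D.p (w.2 t) (bidAt A D w.1 w.2 t) := by
  have hsum (w : A.Seed × (ℕ → D.Slot)) :
      ∑ t ∈ Finset.range T, (D.v (w.2 t) : ℝ) * D.x (w.2 t) (bidAt A D w.1 w.2 t) ≤
        ∑ t ∈ Finset.range T, D.p (w.2 t) (bidAt A D w.1 w.2 t) :=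
    Finset.sum_le_sum fun t _ => hD _ _
  have hvalue := integrable_sum_value A D T
  have hpayment := integrable_sum_payment A D T
  have hsum_eq := (integral_eq_iff_of_ae_le hvalue hpayment (ae_of_all _ hsum)).1
    ((integral_mono hvalue hpayment hsum).antisymm h)
  filter_upwards [hsum_eq] with w hw t ht
  exact (Finset.sum_eq_sum_iff_of_le fun t _ => hD _ _).1 hw t (Finset.mem_range.2 ht)

theorem monotone_ite_lt_zero {α β : Type*} [Preorder α] [DecidableLT α] [Preorder β] [Zero β]
    (a : α) {c : β} (hc : 0 ≤ c) : Monotone fun b => if b < a then 0 else c := fun b b' hb => by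
  dsimp only
  split_ifs with hba hba' hba'
  · exact le_rfl
  · exact hc
  · exact absurd (hb.trans_lt hba') hba
  · exact le_rfl

/-- The deterministic query of value `v` that is won exactly by the bids `b ≥ 1`, all of which are
charged `r`. The charges `r = 1` and `r = 0` give the two laws between which an algorithm that has
not yet bid `1` cannot distinguish. -/
def unitReserveLaw (v r : ℝ≥0) (hv : v ≤ 1) (hr : r ≤ 1) : InputLaw where
  Slot := Unit
  law := Measure.dirac ()
  v := fun _ => v
  x := fun _ b => if b < 1 then 0 else 1
  q := fun _ b => if b < 1 then 0 else r
  measurable_v := measurable_const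
  measurable_x := .ite (measurableSet_lt measurable_snd measurable_const)
    measurable_const measurable_const
  measurable_q := .ite (measurableSet_lt measurable_snd measurable_const)
    measurable_const measurable_const
  v_le_one := fun _ => hv
  x_mem := fun _ b => by split_ifs <;> simp
  x_mono := fun _ => monotone_ite_lt_zero 1 zero_le_one
  x_zero := fun _ => if_pos zero_lt_one
  q_mem := fun _ b => by split_ifs <;> simp [hr]
  q_mono := fun _ => monotone_ite_lt_zero 1 r.coe_nonneg
  q_eq_zero := fun _ b h => by
    by_cases hb : b < 1
    · exact if_pos hb
    · exact absurd ((if_neg hb).symm.trans h) one_ne_zero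
  q_le_bid := fun _ b => by
    split_ifs with hb
    · exact b.coe_nonneg
    · exact_mod_cast hr.trans (not_lt.1 hb)

section unitReserveLaw

variable {v r r' : ℝ≥0} (hv : v ≤ 1) (hr : r ≤ 1) (hr' : r' ≤ 1) {b : ℝ≥0}
  {z : (unitReserveLaw v r hv hr).Slot}

theorem unitReserveLaw_x_of_lt (hb : b < 1) : (unitReserveLaw v r hv hr).x z b = 0 :=
  if_pos hb

theorem unitReserveLaw_x_of_le (hb : 1 ≤ b) : (unitReserveLaw v r hv hr).x z b = 1 :=
  if_neg hb.not_gt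

theorem unitReserveLaw_p_of_lt (hb : b < 1) : (unitReserveLaw v r hv hr).p z b = 0 := by
  rw [InputLaw.p, unitReserveLaw_x_of_lt hv hr hb, mul_zero]

theorem unitReserveLaw_p_of_le (hb : 1 ≤ b) : (unitReserveLaw v r hv hr).p z b = r := by
  rw [InputLaw.p, unitReserveLaw_x_of_le hv hr hb, mul_one]
  exact if_neg hb.not_gt

theorem bidAt_unitReserveLaw_congr (A : Algorithm) (s : A.Seed) (z : ℕ → Unit) {t : ℕ}
    (h : ∀ i < t, bidAt A (unitReserveLaw v r hv hr) s z i < 1) :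
    bidAt A (unitReserveLaw v r' hv hr') s z t = bidAt A (unitReserveLaw v r hv hr) s z t :=
  bidAt_congr A s (fun _ _ => rfl) (fun _ _ => rfl) fun i hi =>
    (unitReserveLaw_p_of_lt hv hr' (h i hi)).trans (unitReserveLaw_p_of_lt hv hr (h i hi)).symm

end unitReserveLaw

section LowerBound

variable {A : Algorithm} {v : ℝ≥0} {T : ℕ}

theorem ae_bidAt_lt_one_of_ROSC_unitReserveLaw {r : ℝ≥0} (hvr : v < r) (hr : r ≤ 1)
    (h : ROSC A (unitReserveLaw v r (hvr.le.trans hr) hr) T) :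
    ∀ᵐ w ∂runLaw A (unitReserveLaw v r (hvr.le.trans hr) hr), ∀ t < T,
      bidAt A (unitReserveLaw v r (hvr.le.trans hr) hr) w.1 w.2 t < 1 := by
  set D := unitReserveLaw v r (hvr.le.trans hr) hr
  have hvalue_lt {z : D.Slot} {b : ℝ≥0} (hb : 1 ≤ b) : (D.v z : ℝ) * D.x z b < D.p z b := by
    rw [unitReserveLaw_x_of_le _ _ hb, unitReserveLaw_p_of_le _ _ hb, mul_one]
    exact_mod_cast hvr
  have hvalue_le (z : D.Slot) (b : ℝ≥0) : (D.v z : ℝ) * D.x z b ≤ D.p z b := by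
    rcases lt_or_ge b 1 with hb | hb
    · rw [unitReserveLaw_x_of_lt _ _ hb, unitReserveLaw_p_of_lt _ _ hb, mul_zero]
    · exact (hvalue_lt hb).le
  filter_upwards [ae_value_eq_payment_of_ROSC hvalue_le h] with w hw t ht
  exact lt_of_not_ge fun hb => (hvalue_lt hb).ne (hw t ht)

theorem value_unitReserveLaw_eq_zero {r r' : ℝ≥0} (hvr : v < r) (hr : r ≤ 1) (hr' : r' ≤ 1)
    (h : ROSC A (unitReserveLaw v r (hvr.le.trans hr) hr) T) :
    value A (unitReserveLaw v r' (hvr.le.trans hr) hr') T = 0 := by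
  have hv : v ≤ 1 := hvr.le.trans hr
  -- `runLaw` does not see the charge, so an almost sure event for `r` is one for `r'`.
  have hloses : ∀ᵐ w ∂runLaw A (unitReserveLaw v r' hv hr'),
      ∀ t < T, bidAt A (unitReserveLaw v r hv hr) w.1 w.2 t < 1 :=
    ae_bidAt_lt_one_of_ROSC_unitReserveLaw hvr hr h
  refine integral_eq_zero_of_ae ?_
  filter_upwards [hloses] with w hw
  refine Finset.sum_eq_zero fun t ht => ?_
  have ht : t < T := Finset.mem_range.1 ht
  rw [bidAt_unitReserveLaw_congr hv hr hr' A w.1 w.2 fun i hi => hw i (hi.trans ht),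
    unitReserveLaw_x_of_lt (z := w.2 t) hv hr' (hw t ht), mul_zero]

/-- The algorithm that always bids `1`, the benchmark on queries sold at charge `0`. -/
def bidOne : Algorithm where
  Seed := Unit
  seedLaw := Measure.dirac ()
  bid := fun _ _ _ _ => 1
  measurable_bid := fun _ => measurable_const

theorem bidAt_bidOne (D : InputLaw) (s : bidOne.Seed) (z : ℕ → D.Slot) (t : ℕ) :
    bidAt bidOne D s z t = 1 :=
  rfl

theorem payment_bidOne_unitReserveLaw {r : ℝ≥0} (hv : v ≤ 1) (hr : r ≤ 1) :
    payment bidOne (unitReserveLaw v r hv hr) T = T * r := by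
  have hslot (z : (unitReserveLaw v r hv hr).Slot) : (unitReserveLaw v r hv hr).p z 1 = r :=
    unitReserveLaw_p_of_le hv hr le_rfl
  simp [payment, bidAt_bidOne, hslot]

theorem value_bidOne_unitReserveLaw {r : ℝ≥0} (hv : v ≤ 1) (hr : r ≤ 1) :
    value bidOne (unitReserveLaw v r hv hr) T = T * v := by
  have hslot (z : (unitReserveLaw v r hv hr).Slot) :
      (unitReserveLaw v r hv hr).v z * (unitReserveLaw v r hv hr).x z 1 = v := by
    rw [unitReserveLaw_x_of_le hv hr le_rfl, mul_one]; rfl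
  simp [value, bidAt_bidOne, hslot]

theorem mul_le_optValue_unitReserveLaw {r : ℝ≥0} (hrv : r ≤ v) (hv : v ≤ 1) :
    (T * v : ℝ) ≤ optValue (unitReserveLaw v r hv (hrv.trans hv)) T := by
  have hfeasible : ROSC bidOne (unitReserveLaw v r hv (hrv.trans hv)) T := by
    rw [ROSC, payment_bidOne_unitReserveLaw, value_bidOne_unitReserveLaw]
    gcongr
  exact (value_bidOne_unitReserveLaw hv _).symm.trans_le (value_le_optValue hfeasible)

theorem mul_le_regret_of_ROSC_unitReserveLaw {r : ℝ≥0} (hvr : v < r) (hr : r ≤ 1)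
    (h : ROSC A (unitReserveLaw v r (hvr.le.trans hr) hr) T) : (T * v : ℝ) ≤ regret A T := by
  have hv : v ≤ 1 := hvr.le.trans hr
  calc
    (T * v : ℝ) ≤ optValue (unitReserveLaw v 0 hv zero_le_one) T :=
        mul_le_optValue_unitReserveLaw zero_le hv
    _ = optValue (unitReserveLaw v 0 hv zero_le_one) T
          - value A (unitReserveLaw v 0 hv zero_le_one) T := by
        rw [value_unitReserveLaw_eq_zero hvr hr zero_le_one h, sub_zero]
    _ ≤ regret A T := optValue_sub_value_le_regret A _ T

theorem regret_eq_of_ROSC_unitReserveLaw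
    (h : ∀ (v : ℝ≥0) (hv : v < 1), ROSC A (unitReserveLaw v 1 hv.le le_rfl) T) :
    regret A T = T := by
  have hlower (v : ℝ≥0) (hv : v < 1) : (T * v : ℝ) ≤ regret A T :=
    mul_le_regret_of_ROSC_unitReserveLaw hv le_rfl (h v hv)
  refine (regret_le A T).antisymm ?_
  lift regret A T to ℝ≥0 using by simpa using hlower 0 one_pos with R
  exact_mod_cast NNReal.le_of_forall_lt_one_mul_le (x := T) (y := R) fun v hv => by
    exact_mod_cast (mul_comm (v : ℝ) T).trans_le (hlower v hv)

end LowerBound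

end AutoBidding

end

theorem mainTheorem8_general :
    (∀ T : ℕ, AutoBidding.RespectsROSC AutoBidding.truthful T) ∧
    ∀ (T : ℕ) (A : AutoBidding.Algorithm),
      (∀ (v : ℝ≥0) (hv : v < 1),
        AutoBidding.ROSC A (AutoBidding.unitReserveLaw v 1 hv.le le_rfl) T) →
        AutoBidding.regret A T = T :=
  ⟨AutoBidding.respectsROSC_truthful, fun _ _ => AutoBidding.regret_eq_of_ROSC_unitReserveLaw⟩

theorem mainTheorem8 :
    (∀ T : ℕ, AutoBidding.RespectsROSC AutoBidding.truthful T) ∧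
    (∃ C : ℝ, 0 < C ∧ ∀ T : ℕ, AutoBidding.regret AutoBidding.truthful T ≤ C * (T : ℝ)) ∧
    (∃ c : ℝ, 0 < c ∧ ∀ (T : ℕ) (A : AutoBidding.Algorithm),
      AutoBidding.RespectsROSC A T → c * (T : ℝ) ≤ AutoBidding.regret A T) ∧
    (∃ K : ℝ, 0 < K ∧ ∀ (T : ℕ) (A : AutoBidding.Algorithm),
      AutoBidding.RespectsROSC A T →
        AutoBidding.regret AutoBidding.truthful T ≤ K * AutoBidding.regret A T) := by
  have htruthful := mainTheorem8_general.1
  have hregret {T : ℕ} {A : AutoBidding.Algorithm} (h : AutoBidding.RespectsROSC A T) :=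
    mainTheorem8_general.2 T A fun _ _ => h _
  exact ⟨htruthful, ⟨1, one_pos, fun T => by rw [one_mul, hregret (htruthful T)]⟩,
    ⟨1, one_pos, fun T A h => by rw [one_mul, hregret h]⟩,
    ⟨1, one_pos, fun T A h => by rw [one_mul, hregret (htruthful T), hregret h]⟩⟩
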